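/- Let $S$ be the unilateral shift on $\ell^2(\mathbb{N})$ and let $e_{11}$ be the orthogonal projection onto the first basis vector. For $b\ge 0$ put $$H_1=\tfrac12(S+S^*),\qquad H_2=\tfrac{i}{2}(S^*-S),\qquad H_3=b\,e_{11}.$$ The Clifford spectrum $\Lambda(H_1,H_2,H_3)$ is the set of $(x,y,z)\in\mathbb{R}^3$ for which the spectral localizer $$(H_1-x)\otimes\sigma_x+(H_2-y)\otimes\sigma_y+(H_3-z)\otimes\sigma_z\in \mathbf M_2(\mathcal B(\ell^2(\mathbb{N})))$$ is not invertible, where $$\sigma_x=\begin{bmatrix}0&1\\1&0\end{bmatrix},\quad \sigma_y=\begin{bmatrix}0&-i\\i&0\end{bmatrix},\quad \sigma_z=\begin{bmatrix}1&0\\0&-1\end{bmatrix}.$$ For every $0\le b\le 2.25$, $\Lambda(H_1,H_2,H_3)$ equals the set of points $(x,y,z)\in\mathbb{R}^3$ that satisfy $$b^{4}z+b^{3}r^{2}-3b^{3}z^{2}-b^{3}-b^{2}r^{2}z+3b^{2}z^{3}+2b^{2}z+br^{4}-br^{2}-bz^{4}-bz^{2}+r^{2}z=0,$$ where $r=\sqrt{x^2+y^2}$,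 subject to the constraints $0\le z\le b$ and $x^2+y^2\le 1$. In particular, for $b=1$, $\Lambda(H_1,H_2,H_3)$ is the set of $(x,y,z)\in\mathbb{R}^3$ with $$r^4-z^4+3z^3-4z^2+3z-1=0,\qquad r^2=x^2+y^2\le 1,\qquad 0\le z\le 1.$$ -/

import Mathlib

/-- The relations `Γⱼ* = Γⱼ`, `Γⱼ² = 1` and `Γⱼ Γₖ = -Γₖ Γⱼ` for `j ≠ k`. -/
structure IsCliffordRep {d r : ℕ} (Γ : Fin d → Matrix (Fin r) (Fin r) ℂ) : Prop where
  isHermitian : ∀ j, (Γ j).IsHermitian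
  sq : ∀ j, Γ j * Γ j = 1
  anticomm : ∀ j k, j ≠ k → Γ j * Γ k = -(Γ k * Γ j)

/-- The Pauli spin matrices `σₓ, σ_y, σ_z`. -/
def pauli : Fin 3 → Matrix (Fin 2) (Fin 2) ℂ :=
  ![!![0, 1; 1, 0], !![0, -Complex.I; Complex.I, 0], !![1, 0; 0, -1]]

theorem pauli_isCliffordRep : IsCliffordRep pauli := by
  refine ⟨fun j => ?_, fun j => ?_, fun j k hjk => ?_⟩
  · fin_cases j <;> ext a b <;> fin_cases a <;> fin_cases b <;>
      simp [pauli, Matrix.conjTranspose_apply]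
  · fin_cases j <;> ext a b <;> fin_cases a <;> fin_cases b <;>
      simp [pauli, Matrix.mul_apply]
  · fin_cases j <;> fin_cases k <;>
      first
        | exact absurd rfl hjk
        | (ext a b; fin_cases a <;> fin_cases b <;>
            simp [pauli, Matrix.mul_apply])

section Localizer

variable {𝒜 : Type*} [Ring 𝒜] [Algebra ℂ 𝒜]

/-- The spectral localizer `∑ⱼ (Aⱼ - λⱼ 1) ⊗ Γⱼ` of a `d`-tuple of elements of a unital algebra,
as an `r × r` matrix with entries in the algebra. -/
def spectralLocalizer {d r : ℕ} (Γ : Fin d → Matrix (Fin r) (Fin r) ℂ) (A : Fin d → 𝒜)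
    (lam : Fin d → ℝ) : Matrix (Fin r) (Fin r) 𝒜 :=
  ∑ j, (Γ j).map fun c => c • (A j - algebraMap ℂ 𝒜 (lam j : ℂ))

/-- The Clifford spectrum of a `d`-tuple: the points of `ℝ^d` at which the spectral localizer is
not invertible. -/
def cliffordSpectrum {d r : ℕ} (Γ : Fin d → Matrix (Fin r) (Fin r) ℂ) (A : Fin d → 𝒜) :
    Set (Fin d → ℝ) :=
  {lam | ¬ IsUnit (spectralLocalizer Γ A lam)}

end Localizer

/-- The Hilbert space `ℓ²(ℕ)` of square-summable complex sequences. -/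
abbrev EllTwo : Type := lp (fun _ : ℕ => ℂ) 2

/-- The standard basis vector `e_n` (counting from `0`). -/
noncomputable def basisVec (n : ℕ) : EllTwo := lp.single 2 n (1 : ℂ)

/-- The sequence `(0, f 0, f 1, …)`. -/
def shiftSeq (f : ℕ → ℂ) : ℕ → ℂ
  | 0 => 0
  | n + 1 => f n

theorem memℓp_shiftSeq (f : EllTwo) : Memℓp (shiftSeq f) 2 := by
  have h2 : (0 : ℝ) < (2 : ENNReal).toReal := by norm_num
  refine memℓp_gen ((summable_nat_add_iff 1).mp ?_)
  simpa [shiftSeq] using (lp.memℓp f).summable h2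

/-- The unilateral shift `(f₀, f₁, …) ↦ (0, f₀, f₁, …)` on `ℓ²(ℕ)`. -/
noncomputable def unilateralShift : EllTwo →L[ℂ] EllTwo :=
  LinearMap.mkContinuous
    { toFun := fun f => (⟨shiftSeq f, memℓp_shiftSeq f⟩ : EllTwo)
      map_add' := fun f g => by
        ext n
        change shiftSeq (fun k => f k + g k) n = shiftSeq f n + shiftSeq g n
        cases n <;> simp [shiftSeq]
      map_smul' := fun c f => by
        ext n
        cases n <;> simp [shiftSeq] }
    1 (fun f => by
      have h2 : (0 : ℝ) < (2 : ENNReal).toReal := by norm_num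
      have hs := (memℓp_shiftSeq f).summable h2
      rw [one_mul]
      refine le_of_eq ?_
      rw [lp.norm_eq_tsum_rpow h2, lp.norm_eq_tsum_rpow h2]
      congr 1
      refine (hs.tsum_eq_zero_add).trans ?_
      simp [shiftSeq])

/-- The triple `H₁ = (S + S*)/2`, `H₂ = i(S* - S)/2`, `H₃ = b e₁₁`, where `S` is the unilateral
shift and `e₁₁` is the orthogonal projection onto the first basis vector. -/
noncomputable def toeplitzTriple (b : ℝ) : Fin 3 → (EllTwo →L[ℂ] EllTwo) :=
  let S := unilateralShift
  ![(1 / 2 : ℂ) • (S + S.adjoint),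
    (Complex.I / 2) • (S.adjoint - S),
    (b : ℂ) • InnerProductSpace.rankOne ℂ (basisVec 0) (basisVec 0)]

/-! Put `w = x + iy`, `T = S - w`, `D = b e₁₁ - z`, so the localizer is `L = [[D, T*], [T, -D]]`.
Since `T T* = T* T - e₁₁` and `D` is scalar up to rank one, `L²` is a finite-rank perturbation of
two diagonal copies of `z² + T* T`, which is invertible off the circle `z = 0, |w| = 1`. There
injectivity of `L` implies invertibility (`isUnit_toeplitzLocalizer_of_injective`), so only kernels
matter.

The kernel equations are a linear recurrence for the pairs `(f 0 n, f 1 (n + 1))` plus two boundary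
equations. Boundedness kills the component along the characteristic root `m > |w|`; for `b ≠ z` the
boundary equations fix the ratio `f 1 1 : f 0 0`, and eliminating `m` gives the polynomial, while
signs give the constraints (`toeplitzPoly_of_kernel`). Conversely, points of the surface carry
explicit kernel vectors, mostly geometric (`not_isUnit_toeplitzLocalizer_of_poly`); on the circle
surjectivity fails instead. -/

/-! ### Operator matrices and finite-rank perturbations. -/

section MatrixOperators

variable {V : Type*} [NormedAddCommGroup V] [NormedSpace ℂ V] {n : ℕ}

/-- Square matrices of bounded operators on `V` are the bounded operators on `Vⁿ`. -/
noncomputable def matrixCLM :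
    Matrix (Fin n) (Fin n) (V →L[ℂ] V) ≃* ((Fin n → V) →L[ℂ] (Fin n → V)) where
  toFun P := ContinuousLinearMap.pi fun i =>
    ∑ j, (P i j).comp (ContinuousLinearMap.proj (R := ℂ) (φ := fun _ : Fin n => V) j)
  invFun f := fun i j =>
    ((ContinuousLinearMap.proj (R := ℂ) (φ := fun _ : Fin n => V) i).comp f).comp
      (ContinuousLinearMap.single ℂ (fun _ : Fin n => V) j)
  left_inv P := by
    ext i j v
    simp only [ContinuousLinearMap.comp_apply, ContinuousLinearMap.proj_apply,
      ContinuousLinearMap.coe_pi', sum_apply,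
      ContinuousLinearMap.single_apply]
    rw [Finset.sum_eq_single j]
    · simp
    · intro k _ hk
      simp [Pi.single_eq_of_ne hk]
    · simp
  right_inv f := by
    ext v i
    simp only [ContinuousLinearMap.comp_apply, ContinuousLinearMap.proj_apply,
      ContinuousLinearMap.coe_pi', sum_apply,
      ContinuousLinearMap.single_apply]
    rw [← Finset.sum_apply, ← map_sum, Finset.univ_sum_single]
  map_mul' P Q := by
    ext v i
    simp only [ContinuousLinearMap.comp_apply, ContinuousLinearMap.proj_apply,
      ContinuousLinearMap.coe_pi', sum_apply, ContinuousLinearMap.mul_def,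
      Matrix.mul_apply, map_sum]
    exact Finset.sum_comm

theorem matrixCLM_apply (P : Matrix (Fin n) (Fin n) (V →L[ℂ] V)) (v : Fin n → V) (i : Fin n) :
    matrixCLM P v i = ∑ j, P i j (v j) := by
  change (∑ j, (P i j).comp (ContinuousLinearMap.proj (R := ℂ) (φ := fun _ : Fin n => V) j)) v = _
  simp

theorem isUnit_matrix_iff_bijective [CompleteSpace V] (P : Matrix (Fin n) (Fin n) (V →L[ℂ] V)) :
    IsUnit P ↔ Function.Bijective (matrixCLM P) := by
  rw [← ContinuousLinearMap.isUnit_iff_bijective, MulEquiv.isUnit_map]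

end MatrixOperators

/-- An injective perturbation of a bijective linear map by a map of finite rank is surjective. -/
theorem LinearMap.surjective_of_injective_of_finite_rank {K V : Type*} [Field K] [AddCommGroup V]
    [Module K V] (e : V ≃ₗ[K] V) (f : V →ₗ[K] V) (W : Submodule K V) [FiniteDimensional K W]
    (hf : ∀ v, f v - e v ∈ W) (hinj : Function.Injective f) :
    Function.Surjective f := by
  -- `k = e⁻¹ f` is the identity modulo `U`, so it preserves `U`; there injectivity gives
  -- surjectivity by dimension, and `U` absorbs the error `k (e⁻¹ y) - e⁻¹ y`.
  let U : Submodule K V := W.map (e.symm : V →ₗ[K] V)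
  let k : V →ₗ[K] V := (e.symm : V →ₗ[K] V) ∘ₗ f
  have hk : ∀ v, k v - v ∈ U := fun v => ⟨f v - e v, hf v, by simp [k]⟩
  have hU : ∀ u ∈ U, k u ∈ U := fun u hu => by
    simpa using U.add_mem (hk u) hu
  have hkinj : Function.Injective (k.restrict hU) := fun u v huv =>
    Subtype.ext (hinj (e.symm.injective (congrArg Subtype.val huv)))
  have hksurj := LinearMap.injective_iff_surjective.mp hkinj
  intro y
  obtain ⟨u, hu⟩ := hksurj ⟨_, hk (e.symm y)⟩
  refine ⟨e.symm y - u, e.symm.injective ?_⟩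
  have h1 : k u = k (e.symm y) - e.symm y := congrArg Subtype.val hu
  change k (e.symm y - u) = e.symm y
  rw [map_sub, h1, sub_sub_cancel]

/-! ### The shift and the entries of the localizer. -/

theorem ellTwo_add_apply (f g : EllTwo) (n : ℕ) : (f + g) n = f n + g n := rfl

theorem ellTwo_sub_apply (f g : EllTwo) (n : ℕ) : (f - g) n = f n - g n := rfl

theorem ellTwo_smul_apply (c : ℂ) (f : EllTwo) (n : ℕ) : (c • f) n = c * f n := rfl

@[simp] theorem unilateralShift_apply_zero (f : EllTwo) : unilateralShift f 0 = 0 := rfl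

@[simp] theorem unilateralShift_apply_succ (f : EllTwo) (n : ℕ) :
    unilateralShift f (n + 1) = f n := rfl

theorem basisVec_apply (m n : ℕ) : basisVec m n = if n = m then 1 else 0 := by
  rw [basisVec, lp.single_apply, Pi.single_apply]

theorem inner_basisVec (n : ℕ) (f : EllTwo) : inner ℂ (basisVec n) f = f n := by
  rw [basisVec, lp.inner_single_left]
  simp

theorem unilateralShift_basisVec (n : ℕ) : unilateralShift (basisVec n) = basisVec (n + 1) := by
  ext k
  cases k <;> simp [basisVec_apply]

@[simp] theorem adjoint_unilateralShift_apply (f : EllTwo) (n : ℕ) :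
    unilateralShift.adjoint f n = f (n + 1) := by
  rw [← inner_basisVec, ContinuousLinearMap.adjoint_inner_right, unilateralShift_basisVec,
    inner_basisVec]

theorem norm_unilateralShift (f : EllTwo) : ‖unilateralShift f‖ = ‖f‖ := by
  have h : unilateralShift.adjoint (unilateralShift f) = f := by
    ext n
    simp
  have h2 : inner ℂ (unilateralShift f) (unilateralShift f) = inner ℂ f f := by
    rw [← ContinuousLinearMap.adjoint_inner_right, h]
  rw [norm_eq_sqrt_re_inner (𝕜 := ℂ), h2, ← norm_eq_sqrt_re_inner]

/-- The off-diagonal entry `S - w` of the spectral localizer. -/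
noncomputable def shiftSub (w : ℂ) : EllTwo →L[ℂ] EllTwo :=
  unilateralShift - w • 1

/-- The diagonal entry `b e₁₁ - z` of the spectral localizer. -/
noncomputable def diagEntry (b z : ℝ) : EllTwo →L[ℂ] EllTwo :=
  (b : ℂ) • InnerProductSpace.rankOne ℂ (basisVec 0) (basisVec 0) - (z : ℂ) • 1

theorem adjoint_shiftSub (w : ℂ) :
    (shiftSub w).adjoint = unilateralShift.adjoint - (starRingEnd ℂ w) • 1 := by
  rw [shiftSub, map_sub, map_smulₛₗ, ContinuousLinearMap.adjoint_one]

theorem spectralLocalizer_toeplitzTriple (b x y z : ℝ) :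
    spectralLocalizer pauli (toeplitzTriple b) ![x, y, z] =
      !![diagEntry b z, (shiftSub ⟨x, y⟩).adjoint; shiftSub ⟨x, y⟩, -diagEntry b z] := by
  have hw : (⟨x, y⟩ : ℂ) = x + y * Complex.I := Complex.mk_eq_add_mul_I x y
  rw [adjoint_shiftSub, shiftSub, diagEntry, hw]
  have hI := Complex.I_mul_I
  refine Matrix.ext fun i j => ?_
  fin_cases i <;> fin_cases j <;>
    simp [spectralLocalizer, Fin.sum_univ_three, Matrix.add_apply, pauli, toeplitzTriple,
      Algebra.algebraMap_eq_smul_one, -Complex.coe_smul] <;>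
    match_scalars <;> first | ring1 | linear_combination hI / 2 | linear_combination -hI / 2

/-- As `S` is isometric, `‖(S - w) u‖ ≥ |1 - ‖w‖| ‖u‖`, so the quadratic form is at least `(z² + (1
- ‖w‖)²) ‖u‖²`. -/
theorem isUnit_adjoint_mul_shiftSub (z : ℝ) (w : ℂ) (h : ¬ (z = 0 ∧ ‖w‖ = 1)) :
    IsUnit (((z : ℂ) ^ 2) • (1 : EllTwo →L[ℂ] EllTwo) +
      (shiftSub w).adjoint.comp (shiftSub w)) := by
  have hc : 0 < z ^ 2 + (1 - ‖w‖) ^ 2 := by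
    by_contra hn
    refine h ⟨?_, ?_⟩ <;> nlinarith [sq_nonneg z, sq_nonneg (1 - ‖w‖)]
  refine ContinuousLinearMap.isUnit_of_forall_le_norm_inner_map _
    (c := ⟨z ^ 2 + (1 - ‖w‖) ^ 2, hc.le⟩) hc fun u => ?_
  have hT : |1 - ‖w‖| * ‖u‖ ≤ ‖shiftSub w u‖ := by
    have h1 := abs_norm_sub_norm_le (unilateralShift u) (w • u)
    rw [norm_unilateralShift, norm_smul] at h1
    calc |1 - ‖w‖| * ‖u‖ = |(1 - ‖w‖) * ‖u‖| := by rw [abs_mul, abs_norm]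
      _ = |‖u‖ - ‖w‖ * ‖u‖| := by ring_nf
      _ ≤ _ := h1
  have hin : inner ℂ ((((z : ℂ) ^ 2) • (1 : EllTwo →L[ℂ] EllTwo) +
      (shiftSub w).adjoint.comp (shiftSub w)) u) u =
      ((z ^ 2 * ‖u‖ ^ 2 + ‖shiftSub w u‖ ^ 2 : ℝ) : ℂ) := by
    simp only [add_apply, smul_apply,
      one_apply_eq_self, ContinuousLinearMap.comp_apply, inner_add_left,
      inner_smul_left, ContinuousLinearMap.adjoint_inner_left, inner_self_eq_norm_sq_to_K]
    simp
  rw [hin, Complex.norm_real, Real.norm_of_nonneg (by positivity)]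
  have h2 : (|1 - ‖w‖| * ‖u‖) ^ 2 ≤ ‖shiftSub w u‖ ^ 2 := by gcongr
  rw [mul_pow, sq_abs] at h2
  change ‖u‖ ^ 2 * (z ^ 2 + (1 - ‖w‖) ^ 2) ≤ _
  linarith

/-- The spectral localizer of `toeplitzTriple b` at `(Re w, Im w, z)`. -/
noncomputable def toeplitzLocalizer (b z : ℝ) (w : ℂ) :
    Matrix (Fin 2) (Fin 2) (EllTwo →L[ℂ] EllTwo) :=
  !![diagEntry b z, (shiftSub w).adjoint; shiftSub w, -diagEntry b z]

theorem matrixCLM_toeplitzLocalizer_zero (b z : ℝ) (w : ℂ) (f : Fin 2 → EllTwo) :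
    matrixCLM (toeplitzLocalizer b z w) f 0 =
      diagEntry b z (f 0) + (shiftSub w).adjoint (f 1) := by
  simp [matrixCLM_apply, toeplitzLocalizer, Fin.sum_univ_two]

theorem matrixCLM_toeplitzLocalizer_one (b z : ℝ) (w : ℂ) (f : Fin 2 → EllTwo) :
    matrixCLM (toeplitzLocalizer b z w) f 1 = shiftSub w (f 0) - diagEntry b z (f 1) := by
  simp [matrixCLM_apply, toeplitzLocalizer, Fin.sum_univ_two, sub_eq_add_neg]

theorem diagEntry_apply (b z : ℝ) (u : EllTwo) :
    diagEntry b z u = ((b : ℂ) * u 0) • basisVec 0 - (z : ℂ) • u := by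
  rw [← inner_basisVec 0 u]
  simp [diagEntry, smul_smul, -Complex.coe_smul]

/-- This is `S* S = 1` against `S S* = 1 - e₁₁`; the scalar `w` drops out of the commutator. -/
theorem shiftSub_adjoint_comm (w : ℂ) (u : EllTwo) :
    shiftSub w ((shiftSub w).adjoint u) =
      (shiftSub w).adjoint (shiftSub w u) - u 0 • basisVec 0 := by
  rw [adjoint_shiftSub, shiftSub]
  ext n
  simp only [sub_apply, smul_apply, one_apply_eq_self, map_sub, map_smul, ellTwo_sub_apply,
    ellTwo_smul_apply]
  cases n <;> simp [basisVec_apply] <;> ring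

theorem isUnit_toeplitzLocalizer_of_injective (b z : ℝ) (w : ℂ) (h : ¬ (z = 0 ∧ ‖w‖ = 1))
    (hinj : Function.Injective (matrixCLM (toeplitzLocalizer b z w))) :
    IsUnit (toeplitzLocalizer b z w) := by
  rw [isUnit_matrix_iff_bijective]
  refine ⟨hinj, ?_⟩
  set P := matrixCLM (toeplitzLocalizer b z w)
  let G := ((z : ℂ) ^ 2) • (1 : EllTwo →L[ℂ] EllTwo) + (shiftSub w).adjoint.comp (shiftSub w)
  let e₀ : EllTwo ≃ₗ[ℂ] EllTwo := LinearEquiv.ofBijective (G : EllTwo →ₗ[ℂ] EllTwo)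
    (ContinuousLinearMap.isUnit_iff_bijective.mp (isUnit_adjoint_mul_shiftSub z w h))
  have he₀ : ∀ u, e₀ u = (z : ℂ) ^ 2 • u + (shiftSub w).adjoint (shiftSub w u) := fun u => rfl
  -- These three directions contain both components of the deviation of `P²` from `diag(e₀, e₀)`.
  let W₀ : Submodule ℂ EllTwo := Submodule.span ℂ
    {basisVec 0, shiftSub w (basisVec 0), (shiftSub w).adjoint (basisVec 0)}
  have hW0 : basisVec 0 ∈ W₀ := Submodule.subset_span (by simp)
  have hW1 : shiftSub w (basisVec 0) ∈ W₀ := Submodule.subset_span (by simp)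
  have hW2 : (shiftSub w).adjoint (basisVec 0) ∈ W₀ := Submodule.subset_span (by simp)
  have hW0fd : W₀.FG := Submodule.fg_span (by simp)
  let W : Submodule ℂ (Fin 2 → EllTwo) := Submodule.pi Set.univ fun _ => W₀
  have hWfd : FiniteDimensional ℂ W :=
    Module.Finite.iff_fg.mpr (Submodule.fg_pi fun _ => hW0fd)
  have hsurj : Function.Surjective
      ((P : (Fin 2 → EllTwo) →ₗ[ℂ] (Fin 2 → EllTwo)) ∘ₗ
        (P : (Fin 2 → EllTwo) →ₗ[ℂ] (Fin 2 → EllTwo))) := by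
    refine LinearMap.surjective_of_injective_of_finite_rank
      (LinearEquiv.piCongrRight fun _ : Fin 2 => e₀) _ W (fun v => ?_) (hinj.comp hinj)
    rw [Submodule.mem_pi]
    intro i _
    change P (P v) i - e₀ (v i) ∈ W₀
    rw [he₀]
    fin_cases i
    · change P (P v) 0 - ((z : ℂ) ^ 2 • v 0 + (shiftSub w).adjoint (shiftSub w (v 0))) ∈ W₀
      have : P (P v) 0 - ((z : ℂ) ^ 2 • v 0 + (shiftSub w).adjoint (shiftSub w (v 0))) =
          ((b : ℂ) * (P v 0) 0 - z * b * (v 0) 0) • basisVec 0 -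
            ((b : ℂ) * (v 1) 0) • (shiftSub w).adjoint (basisVec 0) := by
        rw [matrixCLM_toeplitzLocalizer_zero, matrixCLM_toeplitzLocalizer_one,
          diagEntry_apply b z (P v 0)]
        rw [show (z : ℂ) • P v 0 = (z : ℂ) • _ from
          congrArg _ (matrixCLM_toeplitzLocalizer_zero b z w v), diagEntry_apply,
          diagEntry_apply, map_sub, map_sub, map_smul, map_smul]
        module
      rw [this]
      exact W₀.sub_mem (W₀.smul_mem _ hW0) (W₀.smul_mem _ hW2)
    · change P (P v) 1 - ((z : ℂ) ^ 2 • v 1 + (shiftSub w).adjoint (shiftSub w (v 1))) ∈ W₀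
      have : P (P v) 1 - ((z : ℂ) ^ 2 • v 1 + (shiftSub w).adjoint (shiftSub w (v 1))) =
          ((b : ℂ) * (v 0) 0) • shiftSub w (basisVec 0) -
            ((b : ℂ) * (P v 1) 0 + z * b * (v 1) 0 + (v 1) 0) • basisVec 0 := by
        rw [matrixCLM_toeplitzLocalizer_one, matrixCLM_toeplitzLocalizer_zero,
          diagEntry_apply b z (P v 1)]
        rw [show (z : ℂ) • P v 1 = (z : ℂ) • _ from
          congrArg _ (matrixCLM_toeplitzLocalizer_one b z w v), diagEntry_apply,
          diagEntry_apply, map_add, shiftSub_adjoint_comm, map_sub, map_smul, map_smul]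
        module
      rw [this]
      exact W₀.sub_mem (W₀.smul_mem _ hW1) (W₀.smul_mem _ hW0)
  exact Function.Surjective.of_comp hsurj

/-! ### The kernel equations in coordinates. -/

section Coordinates

variable (b z : ℝ) (w : ℂ) (f : Fin 2 → EllTwo) (n : ℕ)

theorem toeplitzLocalizer_zero_zero : matrixCLM (toeplitzLocalizer b z w) f 0 0 =
    (b - z) * f 0 0 + f 1 1 - starRingEnd ℂ w * f 1 0 := by
  rw [matrixCLM_toeplitzLocalizer_zero, adjoint_shiftSub, diagEntry_apply]
  simp only [sub_apply, smul_apply, one_apply_eq_self, ellTwo_sub_apply, ellTwo_add_apply,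
    ellTwo_smul_apply, basisVec_apply, adjoint_unilateralShift_apply]
  simp
  ring

theorem toeplitzLocalizer_zero_succ : matrixCLM (toeplitzLocalizer b z w) f 0 (n + 1) =
    f 1 (n + 2) - z * f 0 (n + 1) - starRingEnd ℂ w * f 1 (n + 1) := by
  rw [matrixCLM_toeplitzLocalizer_zero, adjoint_shiftSub, diagEntry_apply]
  simp only [sub_apply, smul_apply, one_apply_eq_self, ellTwo_sub_apply, ellTwo_add_apply,
    ellTwo_smul_apply, basisVec_apply, adjoint_unilateralShift_apply]
  simp
  ring

theorem toeplitzLocalizer_one_zero : matrixCLM (toeplitzLocalizer b z w) f 1 0 =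
    -(w * f 0 0) - (b - z) * f 1 0 := by
  rw [matrixCLM_toeplitzLocalizer_one, shiftSub, diagEntry_apply]
  simp only [sub_apply, smul_apply, one_apply_eq_self, ellTwo_sub_apply,
    ellTwo_smul_apply, basisVec_apply, unilateralShift_apply_zero]
  simp
  ring

theorem toeplitzLocalizer_one_succ : matrixCLM (toeplitzLocalizer b z w) f 1 (n + 1) =
    f 0 n - w * f 0 (n + 1) + z * f 1 (n + 1) := by
  rw [matrixCLM_toeplitzLocalizer_one, shiftSub, diagEntry_apply]
  simp only [sub_apply, smul_apply, one_apply_eq_self, ellTwo_sub_apply,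
    ellTwo_smul_apply, basisVec_apply, unilateralShift_apply_succ]
  simp

theorem toeplitzLocalizer_apply_eq_zero_iff : matrixCLM (toeplitzLocalizer b z w) f = 0 ↔
    (b - z) * f 0 0 + f 1 1 = starRingEnd ℂ w * f 1 0 ∧ w * f 0 0 = -(b - z) * f 1 0 ∧
    (∀ n, f 0 n = w * f 0 (n + 1) - z * f 1 (n + 1)) ∧
    (∀ n, f 1 (n + 2) = z * f 0 (n + 1) + starRingEnd ℂ w * f 1 (n + 1)) := by
  constructor
  · intro h
    have h0 : ∀ i n, matrixCLM (toeplitzLocalizer b z w) f i n = 0 := fun i n => by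
      rw [h]; rfl
    refine ⟨?_, ?_, fun n => ?_, fun n => ?_⟩
    · linear_combination (toeplitzLocalizer_zero_zero b z w f).symm.trans (h0 0 0)
    · linear_combination -((toeplitzLocalizer_one_zero b z w f).symm.trans (h0 1 0))
    · linear_combination (toeplitzLocalizer_one_succ b z w f n).symm.trans (h0 1 (n + 1))
    · linear_combination (toeplitzLocalizer_zero_succ b z w f n).symm.trans (h0 0 (n + 1))
  · rintro ⟨h1, h2, h3, h4⟩
    have h0 : ∀ n, matrixCLM (toeplitzLocalizer b z w) f 0 n = 0 := fun n => by
      cases n with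
      | zero => rw [toeplitzLocalizer_zero_zero]; linear_combination h1
      | succ n => rw [toeplitzLocalizer_zero_succ]; linear_combination h4 n
    have h1 : ∀ n, matrixCLM (toeplitzLocalizer b z w) f 1 n = 0 := fun n => by
      cases n with
      | zero => rw [toeplitzLocalizer_one_zero]; linear_combination -h2
      | succ n => rw [toeplitzLocalizer_one_succ]; linear_combination h3 n
    funext i
    refine lp.ext (funext fun n => ?_)
    fin_cases i
    · exact h0 n
    · exact h1 n

end Coordinates

/-! ### From kernel vectors to the polynomial. -/

theorem eq_zero_of_bounded_of_mul_eq {y : ℕ → ℂ} {B m : ℝ} {w : ℂ} (hB : ∀ n, ‖y n‖ ≤ B)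
    (hwm : ‖w‖ < m) (hy : ∀ n, m * y n = w * y (n + 1)) (n : ℕ) : y n = 0 := by
  have hm : 0 < m := (norm_nonneg w).trans_lt hwm
  have hstep : ∀ n, ‖y n‖ = ‖w‖ / m * ‖y (n + 1)‖ := fun n => by
    have h := congrArg norm (hy n)
    rw [norm_mul, norm_mul, Complex.norm_real, Real.norm_of_nonneg hm.le] at h
    field_simp
    linarith
  have hpow : ∀ k n, ‖y n‖ ≤ (‖w‖ / m) ^ k * B := by
    intro k
    induction k with
    | zero => simpa using hB
    | succ k ih =>
      intro n
      rw [hstep n, pow_succ', mul_assoc]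
      exact mul_le_mul_of_nonneg_left (ih (n + 1)) (by positivity)
  have hlim : Filter.Tendsto (fun k : ℕ => (‖w‖ / m) ^ k * B) Filter.atTop (nhds 0) := by
    simpa using (tendsto_pow_atTop_nhds_zero_of_lt_one (by positivity)
      ((div_lt_one hm).mpr hwm)).mul_const B
  exact norm_le_zero_iff.mp (ge_of_tendsto' hlim fun k => hpow k n)

/-- The larger root of `m² - (1 + r² + z²) m + r²`. The roots have product `r²`, and both equal `r`
only in the excluded case. -/
theorem exists_charRoot {r z : ℝ} (hr : 0 ≤ r) (h : ¬ (z = 0 ∧ r = 1)) :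
    ∃ m : ℝ, r < m ∧ (m - 1) * (m - r ^ 2) = z ^ 2 * m := by
  have hpos : 0 < z ^ 2 + (1 - r) ^ 2 := by
    by_contra hn
    refine h ⟨?_, ?_⟩ <;> nlinarith [sq_nonneg z, sq_nonneg (1 - r)]
  have hD : 0 ≤ (1 + r ^ 2 + z ^ 2) ^ 2 - 4 * r ^ 2 := by
    nlinarith [sq_nonneg z, sq_nonneg (1 - r)]
  have h1 := Real.sqrt_nonneg ((1 + r ^ 2 + z ^ 2) ^ 2 - 4 * r ^ 2)
  have h2 := Real.sq_sqrt hD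
  refine ⟨(1 + r ^ 2 + z ^ 2 + √((1 + r ^ 2 + z ^ 2) ^ 2 - 4 * r ^ 2)) / 2, ?_, ?_⟩
  · linarith
  · linear_combination h2 / 4

/-- The defining polynomial of the spectrum in terms of `c = b - z`. -/
theorem toeplitzPoly_eq (b z r : ℝ) :
    b ^ 4 * z + b ^ 3 * r ^ 2 - 3 * b ^ 3 * z ^ 2 - b ^ 3 - b ^ 2 * r ^ 2 * z
      + 3 * b ^ 2 * z ^ 3 + 2 * b ^ 2 * z + b * r ^ 4 - b * r ^ 2 - b * z ^ 4
      - b * z ^ 2 + r ^ 2 * z =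
    z * ((b - z) ^ 2 + r ^ 2) ^ 2
      - (1 - r ^ 2 - z ^ 2) * ((b - z) ^ 2 + r ^ 2) * (b - z) - z * (b - z) ^ 2 := by
  ring

/-- The polynomial results from eliminating `m` between `h1` and `h2`. Then `m > 1` gives `z c > 0`,
and `z + c ≥ 0` makes both positive. If `r > 1`, then `q > c` and the polynomial `z (q² - c²) + (r²
+ z² - 1) q c` is positive. -/
theorem toeplitzPoly_of_charRoot {c q z r m : ℝ} (hb : 0 ≤ z + c) (hc : c ≠ 0)
    (hq : q = c ^ 2 + r ^ 2) (h : ¬ (z = 0 ∧ r = 1)) (hr : 0 ≤ r) (hrm : r < m)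
    (hm : (m - 1) * (m - r ^ 2) = z ^ 2 * m) (h1 : (m - 1) * q = z * c)
    (h2 : (m - r ^ 2) * c = z * m * q) :
    z * q ^ 2 - (1 - r ^ 2 - z ^ 2) * q * c - z * c ^ 2 = 0 ∧ 0 ≤ z ∧ 0 ≤ c ∧ r ≤ 1 := by
  have hc2 : 0 < c ^ 2 := by positivity
  have hq0 : 0 < q := by rw [hq]; positivity
  have hm0 : 0 < m := hr.trans_lt hrm
  have hz : z ≠ 0 := by
    rintro rfl
    have e1 : m - 1 = 0 := (mul_eq_zero.mp (h1.trans (zero_mul c))).resolve_right hq0.ne'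
    have e2 : m - r ^ 2 = 0 := (mul_eq_zero.mp (h2.trans (by ring))).resolve_right hc
    exact h ⟨rfl, by nlinarith⟩
  have hz2 : 0 < z ^ 2 := by positivity
  -- The factors in `hm` have equal signs; both negative would need `r < m < r²`, hence `1 < r < m`.
  have hm1 : 0 < m - 1 := by
    by_contra hn
    have hprod : 0 < (m - 1) * (m - r ^ 2) := by rw [hm]; positivity
    have h3 : m - r ^ 2 < 0 := by
      by_contra h4
      nlinarith
    nlinarith
  have hzc : 0 < z * c := by rw [← h1]; positivity
  have hpoly : z * q ^ 2 - (1 - r ^ 2 - z ^ 2) * q * c - z * c ^ 2 = 0 := by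
    linear_combination (c - z * q) * h1 - q * h2
  have hz0 : 0 < z := by
    by_contra hn
    have : c < 0 := by
      by_contra h'
      nlinarith
    linarith
  have hc0 : 0 < c := by
    by_contra h'
    nlinarith
  refine ⟨hpoly, hz0.le, hc0.le, ?_⟩
  by_contra hr1
  push Not at hr1
  have hr2 : 1 < r ^ 2 := by nlinarith
  have hqc : c < q := by rw [hq]; nlinarith [sq_nonneg (c - 1)]
  have h5 : 0 < z * (q ^ 2 - c ^ 2) := mul_pos hz0 (by nlinarith)
  have h6 : 0 < (r ^ 2 + z ^ 2 - 1) * (q * c) := mul_pos (by nlinarith) (by positivity)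
  nlinarith

/-- Both functionals satisfy `m y_n = w y_{n+1}` along the recurrence, so they vanish on bounded
solutions. They are proportional by `hm`, but at `z = 0` one of them can be identically zero, so
both are kept. -/
theorem toeplitzLocalizer_kernel_leading {b z m : ℝ} {w : ℂ} {f : Fin 2 → EllTwo}
    (hwm : ‖w‖ < m) (hm : (m - 1) * (m - ‖w‖ ^ 2) = z ^ 2 * m)
    (hf : matrixCLM (toeplitzLocalizer b z w) f = 0) :
    ((z : ℂ) * f 0 0 + (m - 1) * f 1 1 = 0 ∧
      ((m : ℂ) - ‖w‖ ^ 2) * f 0 0 + z * m * f 1 1 = 0) ∧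
    (f ≠ 0 → ¬ (f 0 0 = 0 ∧ f 1 0 = 0 ∧ f 1 1 = 0)) := by
  obtain ⟨-, -, h3, h4⟩ := (toeplitzLocalizer_apply_eq_zero_iff b z w f).mp hf
  have hm0 : (m : ℂ) ≠ 0 := by exact_mod_cast ((norm_nonneg w).trans_lt hwm).ne'
  have hww : starRingEnd ℂ w * w = (‖w‖ : ℂ) ^ 2 := Complex.conj_mul' w
  have hmC : ((m : ℂ) - 1) * (m - (‖w‖ : ℂ) ^ 2) = z ^ 2 * m := by exact_mod_cast hm
  have hbd : ∀ (α β : ℂ) (n : ℕ), ‖α * f 0 n + β * f 1 (n + 1)‖ ≤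
      ‖α‖ * ‖f 0‖ + ‖β‖ * ‖f 1‖ := fun α β n => by
    refine (norm_add_le _ _).trans ?_
    rw [norm_mul, norm_mul]
    gcongr
    · exact lp.norm_apply_le_norm two_ne_zero (f 0) n
    · exact lp.norm_apply_le_norm two_ne_zero (f 1) (n + 1)
  have k1 : ∀ n, (z : ℂ) * f 0 n + (m - 1) * f 1 (n + 1) = 0 :=
    eq_zero_of_bounded_of_mul_eq (hbd z (m - 1)) hwm fun n => by
      rw [h3 n, h4 n]
      linear_combination f 1 (n + 1) * hmC - (m - 1) * f 1 (n + 1) * hww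
  have k2 : ∀ n, ((m : ℂ) - (‖w‖ : ℂ) ^ 2) * f 0 n + (z * m) * f 1 (n + 1) = 0 :=
    eq_zero_of_bounded_of_mul_eq (hbd (m - (‖w‖ : ℂ) ^ 2) (z * m)) hwm fun n => by
      rw [h3 n, h4 n]
      linear_combination w * f 0 (n + 1) * hmC - z * m * f 1 (n + 1) * hww
  refine ⟨⟨k1 0, k2 0⟩, fun hne h => hne ?_⟩
  have key : ∀ n, f 0 n = 0 ∧ f 1 (n + 1) = 0 := by
    intro n
    induction n with
    | zero => exact ⟨h.1, h.2.2⟩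
    | succ n ih =>
      have e1 := h4 n
      rw [ih.2, mul_zero, add_zero] at e1
      have e2 : f 1 (n + 2) = 0 := by
        have := k1 (n + 1)
        rw [← e1] at this
        exact (mul_eq_zero.mp (show (m : ℂ) * f 1 (n + 2) = 0 by linear_combination this)
          ).resolve_left hm0
      refine ⟨?_, e2⟩
      have e3 := k2 (n + 1)
      have e4 := h3 n
      rw [ih.1, ih.2] at e4
      rw [e2] at e3
      -- At `w = 0` the recurrence `h3` loses `f 0 (n + 1)`; the functional `k2` recovers it.
      by_cases hw : w = 0
      · subst hw
        refine (mul_eq_zero.mp ?_).resolve_left hm0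
        simpa using e3
      · exact (mul_eq_zero.mp (show w * f 0 (n + 1) = 0 by linear_combination -e4)
          ).resolve_left hw
  funext i
  refine lp.ext (funext fun n => ?_)
  fin_cases i
  · exact (key n).1
  · cases n with
    | zero => exact h.2.1
    | succ n => exact (key n).2

theorem toeplitzPoly_of_kernel {b z : ℝ} {w : ℂ} {f : Fin 2 → EllTwo} (hb : 0 ≤ b)
    (h : ¬ (z = 0 ∧ ‖w‖ = 1)) (hf : matrixCLM (toeplitzLocalizer b z w) f = 0) (hne : f ≠ 0) :
    z * ((b - z) ^ 2 + ‖w‖ ^ 2) ^ 2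
      - (1 - ‖w‖ ^ 2 - z ^ 2) * ((b - z) ^ 2 + ‖w‖ ^ 2) * (b - z) - z * (b - z) ^ 2 = 0 ∧
    0 ≤ z ∧ z ≤ b ∧ ‖w‖ ≤ 1 := by
  obtain ⟨m, hwm, hm⟩ := exists_charRoot (norm_nonneg w) h
  obtain ⟨⟨k1, k2⟩, k3⟩ := toeplitzLocalizer_kernel_leading hwm hm hf
  obtain ⟨h1, h2, -, -⟩ := (toeplitzLocalizer_apply_eq_zero_iff b z w f).mp hf
  have hlead := k3 hne
  have hm0 : m ≠ 0 := ((norm_nonneg w).trans_lt hwm).ne'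
  have hww : starRingEnd ℂ w * w = (‖w‖ : ℂ) ^ 2 := Complex.conj_mul' w
  by_cases hc : b - z = 0
  · have hbz : b = z := sub_eq_zero.mp hc
    subst hbz
    simp only [sub_self, zero_mul, zero_add, neg_zero, mul_eq_zero] at h1 h2
    by_cases hw : w = 0
    · subst hw
      simp [hb]
    · have hu := h2.resolve_left hw
      rw [hu, mul_zero, zero_add] at k1 k2
      have hv : f 1 1 ≠ 0 := by
        intro hv
        have : w = 0 ∨ f 1 0 = 0 := by simpa [hv] using h1.symm
        exact hlead ⟨hu, this.resolve_left hw, hv⟩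
      have e1 : (m : ℂ) - 1 = 0 := (mul_eq_zero.mp k1).resolve_right hv
      have e2 : (b : ℂ) * m = 0 := (mul_eq_zero.mp k2).resolve_right hv
      have e3 : b = 0 := (mul_eq_zero.mp (by exact_mod_cast e2)).resolve_right hm0
      have e4 : m = 1 := sub_eq_zero.mp (by exact_mod_cast e1)
      subst e3
      rw [e4] at hwm
      simp [hwm.le]
  · have hu : f 0 0 ≠ 0 := by
      intro hu
      have hcC : -((b : ℂ) - z) ≠ 0 := neg_ne_zero.mpr (by exact_mod_cast hc)
      rw [hu, mul_zero] at h1 h2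
      have hv0 := (mul_eq_zero.mp h2.symm).resolve_left hcC
      rw [hv0] at h1
      exact hlead ⟨hu, hv0, by simpa using h1⟩
    -- Eliminates `f 1 0` between the two boundary equations.
    have hv : ((b : ℂ) - z) * f 1 1 = -(((b : ℂ) - z) ^ 2 + (‖w‖ : ℂ) ^ 2) * f 0 0 := by
      linear_combination ((b : ℂ) - z) * h1 + starRingEnd ℂ w * h2 - f 0 0 * hww
    have e1 : ((m : ℂ) - 1) * (((b : ℂ) - z) ^ 2 + (‖w‖ : ℂ) ^ 2) = z * (b - z) :=
      mul_right_cancel₀ hu (by linear_combination (m - 1) * hv - (b - z) * k1)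
    have e2 : ((m : ℂ) - (‖w‖ : ℂ) ^ 2) * (b - z) =
        z * m * (((b : ℂ) - z) ^ 2 + (‖w‖ : ℂ) ^ 2) :=
      mul_right_cancel₀ hu (by linear_combination (b - z) * k2 - z * m * hv)
    obtain ⟨p1, p2, p3, p4⟩ := toeplitzPoly_of_charRoot (z := z) (c := b - z) (by simpa) hc rfl h
      (norm_nonneg w) hwm hm (by exact_mod_cast e1) (by exact_mod_cast e2)
    exact ⟨p1, p2, sub_nonneg.mp p3, p4⟩

/-! ### Non-invertibility on the surface. -/

/-- The geometric sequence `1, a, a², …` in `ℓ²(ℕ)`. -/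
noncomputable def geomVec (a : ℂ) (ha : ‖a‖ < 1) : EllTwo :=
  ⟨fun n => a ^ n, memℓp_gen (by
    have h : ‖a‖ ^ 2 < 1 := by nlinarith [norm_nonneg a]
    refine (summable_geometric_of_lt_one (by positivity) h).congr fun n => ?_
    rw [norm_pow, ← pow_mul, mul_comm, pow_mul]
    norm_num)⟩

theorem geomVec_apply (a : ℂ) (ha : ‖a‖ < 1) (n : ℕ) : geomVec a ha n = a ^ n := rfl

theorem not_isUnit_toeplitzLocalizer_of_kernel {b z : ℝ} {w : ℂ} {f : Fin 2 → EllTwo}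
    (hne : f ≠ 0) (hf : matrixCLM (toeplitzLocalizer b z w) f = 0) :
    ¬ IsUnit (toeplitzLocalizer b z w) := by
  rw [isUnit_matrix_iff_bijective]
  exact fun h => hne (h.1 (hf.trans (map_zero _).symm))

/-- Here the kernel is trivial, so surjectivity is what fails: a preimage of `(0, e₂)` has tails of
constant modulus, hence zero, and the remaining equations force `(b² + 1) w = 0`. -/
theorem not_isUnit_toeplitzLocalizer_circle (b : ℝ) {w : ℂ} (hw : ‖w‖ = 1) :
    ¬ IsUnit (toeplitzLocalizer b 0 w) := by
  rw [isUnit_matrix_iff_bijective]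
  intro h
  obtain ⟨f, hf⟩ := h.2 ![0, basisVec 2]
  have hf0 : ∀ n, matrixCLM (toeplitzLocalizer b 0 w) f 0 n = 0 := fun n => by rw [hf]; rfl
  have hf1 : ∀ n, matrixCLM (toeplitzLocalizer b 0 w) f 1 n = if n = 2 then 1 else 0 :=
    fun n => by rw [hf, ← basisVec_apply]; rfl
  have h00 := (toeplitzLocalizer_zero_zero b 0 w f).symm.trans (hf0 0)
  have h10 := (toeplitzLocalizer_one_zero b 0 w f).symm.trans (hf1 0)
  have h11 := (toeplitzLocalizer_one_succ b 0 w f 0).symm.trans (hf1 1)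
  have h12 := (toeplitzLocalizer_one_succ b 0 w f 1).symm.trans (hf1 2)
  have h0 : ∀ n, ‖f 1 (n + 1)‖ = ‖f 1 1‖ := by
    intro n
    induction n with
    | zero => rfl
    | succ n ih =>
      have := (toeplitzLocalizer_zero_succ b 0 w f n).symm.trans (hf0 (n + 1))
      rw [show f 1 (n + 1 + 1) = starRingEnd ℂ w * f 1 (n + 1) by
        simpa [sub_eq_zero] using this, norm_mul, Complex.norm_conj, hw, one_mul, ih]
  have h1 : ∀ n, ‖f 0 (n + 2)‖ = ‖f 0 2‖ := by
    intro n
    induction n with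
    | zero => rfl
    | succ n ih =>
      have := (toeplitzLocalizer_one_succ b 0 w f (n + 2)).symm.trans (hf1 (n + 3))
      rw [← ih, show f 0 (n + 2) = w * f 0 (n + 3) by
        simpa [sub_eq_zero] using this, norm_mul, hw, one_mul]
  have hlim : ∀ (g : EllTwo) (k : ℕ), (∀ n, ‖g (n + k)‖ = ‖g k‖) → g k = 0 := by
    intro g k hg
    have hs := (lp.memℓp g).summable (by norm_num)
    have ht := ((summable_nat_add_iff k).mpr hs).tendsto_atTop_zero
    simp only [hg] at ht
    have := tendsto_nhds_unique tendsto_const_nhds ht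
    simpa using this
  have hv := hlim (f 1) 1 h0
  have hu := hlim (f 0) 2 h1
  have hww : starRingEnd ℂ w * w = 1 := by rw [Complex.conj_mul', hw]; norm_num
  simp only [Nat.reduceAdd, hu, hv, Complex.ofReal_zero] at h00 h10 h11 h12
  norm_num at h00 h10 h11 h12
  rw [h12] at h11
  have h0w : f 0 0 = w := by linear_combination h11
  have hb2 : ((b : ℂ) ^ 2 + 1) * w = 0 := by
    rw [h0w] at h00 h10
    linear_combination b * h00 - starRingEnd ℂ w * h10 - w * hww
  have hb : (b : ℂ) ^ 2 + 1 ≠ 0 := by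
    exact_mod_cast (by positivity : b ^ 2 + 1 ≠ 0)
  have hw0 : w ≠ 0 := by
    rintro rfl
    simp at hw
  exact mul_ne_zero hb hw0 hb2

theorem not_isUnit_toeplitzLocalizer_of_poly {b z : ℝ} {w : ℂ} (hz : 0 ≤ z) (hzb : z ≤ b)
    (hw : ‖w‖ ≤ 1)
    (hpoly : z * ((b - z) ^ 2 + ‖w‖ ^ 2) ^ 2
      - (1 - ‖w‖ ^ 2 - z ^ 2) * ((b - z) ^ 2 + ‖w‖ ^ 2) * (b - z) - z * (b - z) ^ 2 = 0) :
    ¬ IsUnit (toeplitzLocalizer b z w) := by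
  have hww : starRingEnd ℂ w * w = (‖w‖ : ℂ) ^ 2 := Complex.conj_mul' w
  rcases hzb.eq_or_lt with rfl | hlt
  · rcases hz.eq_or_lt with rfl | hz0
    · rcases hw.eq_or_lt with hw1 | hw1
      · exact not_isUnit_toeplitzLocalizer_circle 0 hw1
      · have ha : ‖starRingEnd ℂ w‖ < 1 := by rwa [Complex.norm_conj]
        refine not_isUnit_toeplitzLocalizer_of_kernel (f := ![0, geomVec _ ha]) (fun h => ?_)
          ((toeplitzLocalizer_apply_eq_zero_iff _ _ _ _).mpr ?_)
        · have : geomVec _ ha 0 = 0 := by rw [show geomVec _ ha = 0 from congrFun h 1]; rfl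
          simp [geomVec_apply] at this
        · simp [geomVec_apply, pow_succ']
    -- With `b = z > 0` the polynomial reduces to `z ‖w‖⁴`.
    · have hw0 : w = 0 := by simpa [hz0.ne'] using hpoly
      subst hw0
      refine not_isUnit_toeplitzLocalizer_of_kernel (f := ![0, basisVec 0]) (fun h => ?_)
        ((toeplitzLocalizer_apply_eq_zero_iff _ _ _ _).mpr ?_)
      · have : basisVec 0 0 = 0 := by rw [show basisVec 0 = 0 from congrFun h 1]; rfl
        simp [basisVec_apply] at this
      · simp [basisVec_apply]
  · have hc : 0 < b - z := sub_pos.mpr hlt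
    rcases hz.eq_or_lt with rfl | hz0
    · have hw1 : ‖w‖ = 1 := by
        have h1 : (1 - ‖w‖ ^ 2) * (((b - 0) ^ 2 + ‖w‖ ^ 2) * (b - 0)) = 0 := by
          linear_combination -hpoly
        have h2 := (mul_eq_zero.mp h1).resolve_right (by positivity)
        nlinarith [norm_nonneg w]
      exact not_isUnit_toeplitzLocalizer_circle b hw1
    · obtain ⟨c, hcdef⟩ : ∃ c, c = b - z := ⟨_, rfl⟩
      rw [← hcdef] at hc hpoly
      obtain ⟨q, hq⟩ : ∃ q, q = c ^ 2 + ‖w‖ ^ 2 := ⟨_, rfl⟩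
      rw [← hq] at hpoly
      have hq0 : 0 < q := by rw [hq]; positivity
      have hd : 0 < q + z * c := by positivity
      -- `μ = 1 / m`, solved from the kernel relation `(m - 1) q = z c`; the polynomial then
      -- supplies the other relation, `hμ2`.
      obtain ⟨μ, hμ⟩ : ∃ μ, μ = q / (q + z * c) := ⟨_, rfl⟩
      have hμd : μ * (q + z * c) = q := by rw [hμ]; field_simp
      have hμ0 : 0 < μ := by rw [hμ]; positivity
      have hμ1 : μ < 1 := by
        rw [hμ, div_lt_one hd]
        nlinarith [mul_pos hz0 hc]
      have hμ2 : c - ‖w‖ ^ 2 * μ * c = z * q := by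
        rw [hμ]
        field_simp
        linear_combination -hpoly
      have ha : ‖starRingEnd ℂ w * μ‖ < 1 := by
        rw [norm_mul, Complex.norm_conj, Complex.norm_real, Real.norm_of_nonneg hμ0.le]
        nlinarith [norm_nonneg w]
      have hcC : (b : ℂ) - z = c := by rw [hcdef]; push_cast; rfl
      have hqC : (q : ℂ) = (c : ℂ) ^ 2 + (‖w‖ : ℂ) ^ 2 := by exact_mod_cast hq
      have hμdC : (μ : ℂ) * (q + z * c) = q := by exact_mod_cast hμd
      have hμ2C : (c : ℂ) - (‖w‖ : ℂ) ^ 2 * μ * c = z * q := by exact_mod_cast hμ2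
      -- Normalizing `f 0 0 = c`, the boundary equations give `f 1 0 = -w` and `f 1 1 = -q`; the
      -- rest decays with ratio `conj w * μ`.
      let f : Fin 2 → EllTwo := ![(c : ℂ) • geomVec _ ha,
        (-w) • basisVec 0 - (q : ℂ) • unilateralShift (geomVec _ ha)]
      have f0 : ∀ n, f 0 n = c * (starRingEnd ℂ w * μ) ^ n := fun n => rfl
      have f10 : f 1 0 = -w := by
        change -w * basisVec 0 0 - (q : ℂ) * (unilateralShift (geomVec _ ha)) 0 = _
        simp [basisVec_apply]
      have f11 : ∀ n, f 1 (n + 1) = -(q * (starRingEnd ℂ w * μ) ^ n) := fun n => by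
        change -w * basisVec 0 (n + 1) - (q : ℂ) * (unilateralShift (geomVec _ ha)) (n + 1) = _
        simp [basisVec_apply, geomVec_apply]
      refine not_isUnit_toeplitzLocalizer_of_kernel (f := f) (fun h => ?_)
          ((toeplitzLocalizer_apply_eq_zero_iff _ _ _ _).mpr ⟨?_, ?_, fun n => ?_, fun n => ?_⟩)
      · have h1 : f 0 0 = 0 := by rw [h]; rfl
        rw [f0, pow_zero, mul_one] at h1
        exact hc.ne' (Complex.ofReal_eq_zero.mp h1)
      · rw [hcC, f0, f10, show f 1 1 = _ from f11 0]
        linear_combination -hqC + hww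
      · rw [hcC, f0, f10]
        ring
      · rw [f0, f0, f11, pow_succ]
        linear_combination (starRingEnd ℂ w * μ) ^ n * hμ2C - c * μ * (starRingEnd ℂ w * μ) ^ n * hww
      · rw [f0, f11 (n + 1), f11 n, pow_succ]
        linear_combination -starRingEnd ℂ w * (starRingEnd ℂ w * μ) ^ n * hμdC

/-! ### Assembly of the Clifford spectrum. -/

theorem not_isUnit_toeplitzLocalizer_iff {b z : ℝ} {w : ℂ} (hb : 0 ≤ b) :
    ¬ IsUnit (toeplitzLocalizer b z w) ↔
      b ^ 4 * z + b ^ 3 * ‖w‖ ^ 2 - 3 * b ^ 3 * z ^ 2 - b ^ 3 - b ^ 2 * ‖w‖ ^ 2 * z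
        + 3 * b ^ 2 * z ^ 3 + 2 * b ^ 2 * z + b * ‖w‖ ^ 4 - b * ‖w‖ ^ 2 - b * z ^ 4
        - b * z ^ 2 + ‖w‖ ^ 2 * z = 0 ∧ 0 ≤ z ∧ z ≤ b ∧ ‖w‖ ≤ 1 := by
  rw [toeplitzPoly_eq]
  constructor
  · intro hu
    by_cases h : z = 0 ∧ ‖w‖ = 1
    · obtain ⟨rfl, hw⟩ := h
      simp [hw, hb]
    · by_contra hn
      refine hu (isUnit_toeplitzLocalizer_of_injective b z w h ?_)
      rw [injective_iff_map_eq_zero]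
      intro f hf
      by_contra hne
      exact hn (toeplitzPoly_of_kernel hb h hf hne)
  · rintro ⟨hp, hz, hzb, hw⟩
    exact not_isUnit_toeplitzLocalizer_of_poly hz hzb hw hp

theorem cliffordSpectrum_toeplitzTriple {b : ℝ} (hb : 0 ≤ b) :
    cliffordSpectrum pauli (toeplitzTriple b) =
      {p : Fin 3 → ℝ | ∃ x y z r : ℝ, p = ![x, y, z] ∧ 0 ≤ r ∧ r ^ 2 = x ^ 2 + y ^ 2 ∧
        b ^ 4 * z + b ^ 3 * r ^ 2 - 3 * b ^ 3 * z ^ 2 - b ^ 3 - b ^ 2 * r ^ 2 * z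
          + 3 * b ^ 2 * z ^ 3 + 2 * b ^ 2 * z + b * r ^ 4 - b * r ^ 2 - b * z ^ 4
          - b * z ^ 2 + r ^ 2 * z = 0 ∧
        0 ≤ z ∧ z ≤ b ∧ x ^ 2 + y ^ 2 ≤ 1} := by
  have hnorm : ∀ x y : ℝ, ‖(⟨x, y⟩ : ℂ)‖ ^ 2 = x ^ 2 + y ^ 2 := fun x y => by
    rw [Complex.sq_norm, Complex.normSq_mk]
    ring
  have hmem : ∀ x y z : ℝ, ![x, y, z] ∈ cliffordSpectrum pauli (toeplitzTriple b) ↔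
      ¬ IsUnit (toeplitzLocalizer b z ⟨x, y⟩) := fun x y z => by
    rw [toeplitzLocalizer, ← spectralLocalizer_toeplitzTriple]
    rfl
  ext p
  constructor
  · intro hp
    obtain ⟨x, y, z, rfl⟩ : ∃ x y z, p = ![x, y, z] :=
      ⟨p 0, p 1, p 2, by ext i; fin_cases i <;> rfl⟩
    rw [hmem, not_isUnit_toeplitzLocalizer_iff hb] at hp
    refine ⟨x, y, z, ‖(⟨x, y⟩ : ℂ)‖, rfl, norm_nonneg _, hnorm x y, hp.1, hp.2.1, hp.2.2.1, ?_⟩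
    rw [← hnorm]
    exact pow_le_one₀ (norm_nonneg _) hp.2.2.2
  · rintro ⟨x, y, z, r, rfl, hr, hrxy, hp, hz, hzb, hxy⟩
    have hrn : r = ‖(⟨x, y⟩ : ℂ)‖ :=
      (sq_eq_sq₀ hr (norm_nonneg _)).mp (hrxy.trans (hnorm x y).symm)
    rw [hmem, not_isUnit_toeplitzLocalizer_iff hb, ← hrn]
    exact ⟨hp, hz, hzb, by nlinarith⟩

theorem mainTheorem3 :
    (∀ b : ℝ, 0 ≤ b → b ≤ 9 / 4 →
      cliffordSpectrum pauli (toeplitzTriple b) =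
        {p : Fin 3 → ℝ | ∃ x y z r : ℝ, p = ![x, y, z] ∧ 0 ≤ r ∧ r ^ 2 = x ^ 2 + y ^ 2 ∧
          b ^ 4 * z + b ^ 3 * r ^ 2 - 3 * b ^ 3 * z ^ 2 - b ^ 3 - b ^ 2 * r ^ 2 * z
            + 3 * b ^ 2 * z ^ 3 + 2 * b ^ 2 * z + b * r ^ 4 - b * r ^ 2 - b * z ^ 4
            - b * z ^ 2 + r ^ 2 * z = 0 ∧
          0 ≤ z ∧ z ≤ b ∧ x ^ 2 + y ^ 2 ≤ 1}) ∧
    cliffordSpectrum pauli (toeplitzTriple 1) =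
      {p : Fin 3 → ℝ | ∃ x y z r : ℝ, p = ![x, y, z] ∧ 0 ≤ r ∧ r ^ 2 = x ^ 2 + y ^ 2 ∧
        r ^ 4 - z ^ 4 + 3 * z ^ 3 - 4 * z ^ 2 + 3 * z - 1 = 0 ∧
        0 ≤ z ∧ z ≤ 1 ∧ r ^ 2 ≤ 1} := by
  refine ⟨fun b hb _ => cliffordSpectrum_toeplitzTriple hb, ?_⟩
  rw [cliffordSpectrum_toeplitzTriple zero_le_one]
  ext p
  constructor
  · rintro ⟨x, y, z, r, hp, hr, hrxy, hpoly, hz, hz1, hxy⟩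
    exact ⟨x, y, z, r, hp, hr, hrxy, by linear_combination hpoly, hz, hz1, hrxy.trans_le hxy⟩
  · rintro ⟨x, y, z, r, hp, hr, hrxy, hpoly, hz, hz1, hxy⟩
    exact ⟨x, y, z, r, hp, hr, hrxy, by linear_combination hpoly, hz, hz1, hrxy.ge.trans hxy⟩
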